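/- Let $G$ be a finite simple undirected graph with vertex set $V$ and adjacency matrix $A_G$, and let $$P_G=\Bigl\{P\in\mathbb R^{V\times V} : PA_G=A_GP,\ \sum_{i\in V}P_{ij}=1 \text{ for all } j\in V,\ \sum_{j\in V}P_{ij}=1 \text{ for all } i\in V,\ P_{ij}\ge 0 \text{ for all } i,j\in V\Bigr\}$$ be the polytope of doubly stochastic matrices commuting with $A_G$. Then $P_G$ is quasi-integral, that is, the subgraph of the 1-skeleton of $P_G$ induced by the vertices of $P_G$ with all entries integers is connected. Here the 1-skeleton is the graph whose vertices are the vertices (extreme points) of $P_G$, two distinct ones being adjacent if the segment between them is a face of $P_G$. -/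

import Mathlib

/-- The polytope `P_G` of a simple graph `G`: the doubly stochastic real matrices (nonnegative
entries, all row and column sums equal to `1`) that commute with the adjacency matrix of `G`. -/
def graphPolytope {V : Type*} [Fintype V] [DecidableEq V] (G : SimpleGraph V)
    [DecidableRel G.Adj] : Set (Matrix V V ℝ) :=
  {P | P ∈ doublyStochastic ℝ V ∧ P * G.adjMatrix ℝ = G.adjMatrix ℝ * P}

/-- The 1-skeleton (vertex-edge graph) of a polytope `P`: its vertices are the vertices (extreme
points) of `P`, and two distinct vertices are adjacent when the segment between them is a face of
`P`, i.e. the set of maximizers over `P` of some linear functional. -/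
def oneSkeleton {E : Type*} [AddCommGroup E] [Module ℝ E] [TopologicalSpace E] (P : Set E) :
    SimpleGraph (P.extremePoints ℝ) where
  Adj x y := x ≠ y ∧ IsExposed ℝ P (segment ℝ (x : E) (y : E))
  symm := ⟨fun x y h => ⟨h.1.symm, by rw [segment_symm]; exact h.2⟩⟩
  loopless := ⟨fun _ h => h.1 rfl⟩

/-- A real matrix all of whose entries are integers. -/
def IsIntegerMatrix {m n : Type*} (M : Matrix m n ℝ) : Prop :=
  ∀ i j, ∃ z : ℤ, M i j = (z : ℝ)

/-- A polytope of real matrices is quasi-integral if the subgraph of its 1-skeleton induced by its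
integer vertices is connected. -/
def IsQuasiIntegral {m n : Type*} (P : Set (Matrix m n ℝ)) : Prop :=
  ((oneSkeleton P).induce {v : P.extremePoints ℝ | IsIntegerMatrix (v : Matrix m n ℝ)}).Connected

open Matrix Equiv

/-! Integer vertices are the permutation matrices of automorphisms of `G`. For automorphisms `g`,
`h`, the matrices of the polytope supported on the union of their supports form a face
(`isExposed_segment_permMatrix`). If it is only the segment, `g` and `h` are adjacent. Otherwise it
contains a blend of `g` and `h` with nonconstant weights, and rounding these weights yields an
automorphism strictly between `g` and `h` (`exists_between_of_not_mem_segment`). Induct on the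
number of points where `g` and `h` differ. -/

theorem permMatrix_apply_ite {V : Type*} [DecidableEq V] (σ : Perm V) (i j : V) :
    σ.permMatrix ℝ i j = if σ i = j then 1 else 0 := by
  simp [Perm.permMatrix, PEquiv.toMatrix_apply, eq_comm]

theorem sum_permMatrix_mul {V : Type*} [Fintype V] [DecidableEq V] (σ : Perm V) (a : V → ℝ)
    (i : V) : ∑ j, σ.permMatrix ℝ i j * a j = a (σ i) := by
  simp

theorem sum_mul_permMatrix {V : Type*} [Fintype V] [DecidableEq V] (σ : Perm V) (a : V → ℝ)
    (j : V) : ∑ i, a i * σ.permMatrix ℝ i j = a (σ.symm j) := by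
  simp [← Equiv.eq_symm_apply]

theorem exists_eq_permMatrix {V : Type*} [Fintype V] [DecidableEq V] {M : Matrix V V ℝ}
    (hM : M ∈ doublyStochastic ℝ V) (hint : IsIntegerMatrix M) :
    ∃ σ : Perm V, M = σ.permMatrix ℝ := by
  obtain ⟨h0, hr, hc⟩ := mem_doublyStochastic_iff_sum.1 hM
  have h01 : ∀ i j, M i j = 0 ∨ M i j = 1 := by
    intro i j
    obtain ⟨z, hz⟩ := hint i j
    have hle : M i j ≤ 1 :=
      (hr i) ▸ Finset.single_le_sum (f := M i) (fun k _ => h0 i k) (Finset.mem_univ j)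
    have hge := h0 i j
    rw [hz] at hle hge ⊢
    norm_cast at *
    omega
  have hex : ∀ i, ∃ j, M i j = 1 := by
    intro i
    by_contra! hne
    have hz : ∑ j, M i j = 0 := Finset.sum_eq_zero fun j _ => (h01 i j).resolve_right (hne j)
    linarith [hr i]
  choose s hs using hex
  have inj : Function.Injective s := by
    intro i k hik
    by_contra hne
    have h2 := Finset.sum_le_sum_of_subset_of_nonneg (Finset.subset_univ {i, k})
      (fun l _ _ => h0 l (s i))
    rw [Finset.sum_pair hne, hc, hs, hik, hs] at h2
    norm_num at h2
  refine ⟨Equiv.ofBijective s (Finite.injective_iff_bijective.1 inj), ?_⟩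
  ext i j
  rw [permMatrix_apply_ite, Equiv.ofBijective_apply]
  split_ifs with h
  · rw [← h, hs]
  · refine (h01 i j).resolve_right fun h1 => ?_
    have h2 := Finset.sum_le_sum_of_subset_of_nonneg (Finset.subset_univ {s i, j})
      (fun l _ _ => h0 i l)
    rw [Finset.sum_pair h, hr, hs, h1] at h2
    norm_num at h2

theorem isIntegerMatrix_permMatrix {V : Type*} [DecidableEq V] (σ : Perm V) :
    IsIntegerMatrix (σ.permMatrix ℝ) := by
  intro i j
  refine ⟨if σ i = j then 1 else 0, ?_⟩
  rw [permMatrix_apply_ite]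
  split_ifs <;> simp

theorem permMatrix_mem_extremePoints_graphPolytope {V : Type*} [Fintype V] [DecidableEq V]
    (G : SimpleGraph V) [DecidableRel G.Adj] {σ : Perm V}
    (h : σ.permMatrix ℝ ∈ graphPolytope G) :
    σ.permMatrix ℝ ∈ (graphPolytope G).extremePoints ℝ := by
  refine inter_extremePoints_subset_extremePoints_of_subset
    (A := (doublyStochastic ℝ V : Set (Matrix V V ℝ))) (fun P (hP : P ∈ graphPolytope G) => hP.1) ⟨h, ?_⟩
  rw [extremePoints_doublyStochastic]
  exact ⟨σ, rfl⟩

/-- The matrix whose row `i` is the combination `(1 - t i) g + t i h` of the corresponding rows of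
two permutation matrices. -/
def permBlend {V : Type*} [DecidableEq V] (g h : Perm V) (t : V → ℝ) : Matrix V V ℝ :=
  fun i j => (1 - t i) * g.permMatrix ℝ i j + t i * h.permMatrix ℝ i j

theorem sum_permBlend_mul {V : Type*} [Fintype V] [DecidableEq V] (g h : Perm V) (t a : V → ℝ)
    (i : V) : ∑ j, permBlend g h t i j * a j = (1 - t i) * a (g i) + t i * a (h i) := by
  simp only [permBlend, add_mul, mul_assoc, Finset.sum_add_distrib, ← Finset.mul_sum,
    sum_permMatrix_mul]

theorem sum_mul_permBlend {V : Type*} [Fintype V] [DecidableEq V] (g h : Perm V) (t a : V → ℝ)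
    (j : V) : ∑ i, a i * permBlend g h t i j =
      (1 - t (g.symm j)) * a (g.symm j) + t (h.symm j) * a (h.symm j) := by
  have : ∀ i, a i * permBlend g h t i j =
      ((1 - t i) * a i) * g.permMatrix ℝ i j + (t i * a i) * h.permMatrix ℝ i j := by
    intro i; simp only [permBlend]; ring
  simp only [this, Finset.sum_add_distrib, sum_mul_permMatrix]

theorem permMatrix_mul_eq_iff {V : Type*} [Fintype V] [DecidableEq V] (σ : Perm V)
    (A : Matrix V V ℝ) :
    σ.permMatrix ℝ * A = A * σ.permMatrix ℝ ↔ ∀ i l, A (σ i) l = A i (σ.symm l) := by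
  simp only [← Matrix.ext_iff, Matrix.mul_apply]
  refine forall₂_congr fun i l => ?_
  rw [sum_permMatrix_mul σ (fun j => A j l), sum_mul_permMatrix σ (A i)]

/-- Apart from nonnegativity, the conditions involve `t` only through equalities between its values,
so they survive composing `t` with any function. -/
theorem permBlend_mem_graphPolytope_iff {V : Type*} [Fintype V] [DecidableEq V]
    {G : SimpleGraph V} [DecidableRel G.Adj] {g h : Perm V}
    (hg : g.permMatrix ℝ ∈ graphPolytope G) (hh : h.permMatrix ℝ ∈ graphPolytope G) (t : V → ℝ) :
    permBlend g h t ∈ graphPolytope G ↔ (∀ i j, 0 ≤ permBlend g h t i j) ∧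
      (∀ j, t (g.symm j) = t (h.symm j)) ∧
      ∀ i l, t i = t (g.symm l) ∨
        G.adjMatrix ℝ i (g.symm l) = G.adjMatrix ℝ i (h.symm l) := by
  have hgA := (permMatrix_mul_eq_iff _ _).1 hg.2
  have hhA := (permMatrix_mul_eq_iff _ _).1 hh.2
  have hrow : ∀ i, ∑ j, permBlend g h t i j = 1 := fun i => by
    simpa using sum_permBlend_mul g h t (fun _ => 1) i
  have hcol : ∀ j, ∑ i, permBlend g h t i j = 1 - t (g.symm j) + t (h.symm j) := fun j => by
    simpa using sum_mul_permBlend g h t (fun _ => 1) j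
  have key : (∀ j, t (g.symm j) = t (h.symm j)) →
      (permBlend g h t * G.adjMatrix ℝ = G.adjMatrix ℝ * permBlend g h t ↔
        ∀ i l, t i = t (g.symm l) ∨
          G.adjMatrix ℝ i (g.symm l) = G.adjMatrix ℝ i (h.symm l)) := by
    intro ht
    rw [← Matrix.ext_iff]
    refine forall₂_congr fun i l => ?_
    rw [Matrix.mul_apply, Matrix.mul_apply, sum_permBlend_mul g h t (fun j => G.adjMatrix ℝ j l),
      sum_mul_permBlend g h t (G.adjMatrix ℝ i), hgA, hhA, ← ht l]
    -- The difference of the two sides factors, up to sign, as this product.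
    rw [← sub_eq_zero (a := t i), ← sub_eq_zero (a := G.adjMatrix ℝ i _), ← mul_eq_zero]
    constructor <;> intro H <;> linarith
  constructor
  · rintro ⟨hds, hcomm⟩
    obtain ⟨h0, -, hc⟩ := mem_doublyStochastic_iff_sum.1 hds
    have ht : ∀ j, t (g.symm j) = t (h.symm j) := fun j => by linarith [hc j, hcol j]
    exact ⟨h0, ht, (key ht).1 hcomm⟩
  · rintro ⟨h0, ht, hA⟩
    exact ⟨mem_doublyStochastic_iff_sum.2 ⟨h0, hrow, fun j => by rw [hcol, ht]; ring⟩,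
      (key ht).2 hA⟩

theorem eq_permBlend {V : Type*} [Fintype V] [DecidableEq V] {g h : Perm V}
    {X : Matrix V V ℝ} (hr : ∀ i, ∑ j, X i j = 1)
    (hX : ∀ i j, g i ≠ j → h i ≠ j → X i j = 0) :
    -- The value 0 is arbitrary: where `g i = h i`, row `i` of the blend does not depend on the
    -- weight.
    X = permBlend g h fun i => if g i = h i then 0 else X i (h i) := by
  ext i j
  have hg : X i (g i) = 1 - (if g i = h i then 0 else X i (h i)) := by
    rw [eq_sub_iff_add_eq, ← hr i]
    split_ifs with hi
    · rw [add_zero, Finset.sum_eq_single (g i)] <;> simp_all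
      intro b hb; exact hX i b (hi ▸ Ne.symm hb) (Ne.symm hb)
    · rw [Finset.sum_eq_add (g i) (h i) hi] <;> simp
      intro b hb hb'; exact hX i b (Ne.symm hb) (Ne.symm hb')
  simp only [permBlend, permMatrix_apply_ite]
  by_cases h1 : g i = j <;> by_cases h2 : h i = j
  · subst h1; simp [h2, hg]
  · subst h1; simp [h2, hg]
  · subst h2; simp [h1]
  · simp [h1, h2, hX i j h1 h2]

theorem exists_between_of_not_mem_segment {V : Type*} [Fintype V] [DecidableEq V]
    {G : SimpleGraph V} [DecidableRel G.Adj] {g h : Perm V}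
    (hg : g.permMatrix ℝ ∈ graphPolytope G) (hh : h.permMatrix ℝ ∈ graphPolytope G)
    {X : Matrix V V ℝ} (hXG : X ∈ graphPolytope G)
    (hX : ∀ i j, g i ≠ j → h i ≠ j → X i j = 0)
    (hseg : X ∉ segment ℝ (g.permMatrix ℝ) (h.permMatrix ℝ)) :
    ∃ k : Perm V, k.permMatrix ℝ ∈ graphPolytope G ∧ k ≠ g ∧ k ≠ h ∧
      ∀ i, k i = g i ∨ k i = h i := by
  obtain ⟨h0, hr, hc⟩ := mem_doublyStochastic_iff_sum.1 hXG.1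
  have hXt := eq_permBlend hr hX
  set t : V → ℝ := fun i => if g i = h i then 0 else X i (h i) with ht
  have hXle : ∀ i j, X i j ≤ 1 := fun i j =>
    (hr i) ▸ Finset.single_le_sum (f := X i) (fun k _ => h0 i k) (Finset.mem_univ j)
  obtain ⟨i₀, i₁, hi₀, hi₁, hne⟩ : ∃ i₀ i₁, g i₀ ≠ h i₀ ∧ g i₁ ≠ h i₁ ∧ t i₁ ≠ t i₀ := by
    by_contra! H
    obtain ⟨s, hs0, hs1, hs⟩ : ∃ s : ℝ, 0 ≤ s ∧ s ≤ 1 ∧ ∀ i, g i ≠ h i → t i = s := by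
      by_cases hD : ∃ i₀, g i₀ ≠ h i₀
      · obtain ⟨i₀, hi₀⟩ := hD
        refine ⟨t i₀, ?_, ?_, fun i hi => H i₀ i hi₀ hi⟩ <;> simp only [ht, if_neg hi₀]
        exacts [h0 _ _, hXle _ _]
      · push Not at hD
        exact ⟨0, le_rfl, zero_le_one, fun i hi => absurd (hD i) hi⟩
    refine hseg ⟨1 - s, s, by linarith, hs0, by ring, ?_⟩
    rw [hXt]
    ext i j
    simp only [Matrix.add_apply, Matrix.smul_apply, smul_eq_mul, permBlend]
    by_cases hi : g i = h i
    · simp only [permMatrix_apply_ite, hi]; ring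
    · rw [hs i hi]
  obtain ⟨-, htc, htA⟩ := (permBlend_mem_graphPolytope_iff hg hh t).1 (hXt ▸ hXG)
  -- Rounding to the indicator of a level set: `k` will follow `h` on it and `g` off it.
  set u : V → ℝ := fun i => if t i = t i₀ then 1 else 0 with hu
  have hY : permBlend g h u ∈ graphPolytope G := by
    refine (permBlend_mem_graphPolytope_iff hg hh u).2 ⟨fun i j => ?_, fun j => ?_, fun i l => ?_⟩
    · simp only [permBlend, permMatrix_apply_ite, hu]
      split_ifs <;> norm_num
    · simp only [hu, htc]
    · exact (htA i l).imp_left fun e => by simp only [hu, e]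
  have hYint : IsIntegerMatrix (permBlend g h u) := by
    intro i j
    by_cases e : t i = t i₀
    · simpa [permBlend, hu, e] using isIntegerMatrix_permMatrix h i j
    · simpa [permBlend, hu, e] using isIntegerMatrix_permMatrix g i j
  obtain ⟨k, hk⟩ := exists_eq_permMatrix hY.1 hYint
  have hkh : ∀ i, t i = t i₀ → k i = h i := by
    intro i e
    have := congrFun (congrFun hk i) (h i)
    by_contra hne
    simp [permBlend, hu, e, hne] at this
  have hkg : ∀ i, t i ≠ t i₀ → k i = g i := by
    intro i e
    have := congrFun (congrFun hk i) (g i)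
    by_contra hne
    simp [permBlend, hu, e, hne] at this
  refine ⟨k, hk ▸ hY, ?_, ?_, fun i => ?_⟩
  · rintro rfl; exact hi₀ (hkh i₀ rfl)
  · rintro rfl; exact hi₁ (hkg i₁ hne).symm
  · by_cases e : t i = t i₀
    exacts [Or.inr (hkh i e), Or.inl (hkg i e)]

theorem convex_graphPolytope {V : Type*} [Fintype V] [DecidableEq V] (G : SimpleGraph V)
    [DecidableRel G.Adj] : Convex ℝ (graphPolytope G) := by
  rintro P ⟨hP, hPA⟩ Q ⟨hQ, hQA⟩ a b ha hb hab
  exact ⟨convex_doublyStochastic hP hQ ha hb hab, by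
    simp [Matrix.add_mul, Matrix.mul_add, hPA, hQA]⟩

theorem isExposed_segment_permMatrix {V : Type*} [Fintype V] [DecidableEq V]
    {G : SimpleGraph V} [DecidableRel G.Adj] {g h : Perm V}
    (hg : g.permMatrix ℝ ∈ graphPolytope G) (hh : h.permMatrix ℝ ∈ graphPolytope G)
    (hface : ∀ X ∈ graphPolytope G, (∀ i j, g i ≠ j → h i ≠ j → X i j = 0) →
      X ∈ segment ℝ (g.permMatrix ℝ) (h.permMatrix ℝ)) :
    IsExposed ℝ (graphPolytope G) (segment ℝ (g.permMatrix ℝ) (h.permMatrix ℝ)) := by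
  intro _
  -- Minus the total mass off both supports is maximal, with value 0, exactly on the face.
  let W : V → V → ℝ := fun i j => if g i ≠ j ∧ h i ≠ j then 1 else 0
  have hW : ∀ i j, 0 ≤ W i j := fun i j => by simp only [W]; split_ifs <;> norm_num
  let l : Matrix V V ℝ →ₗ[ℝ] ℝ :=
    { toFun := fun X => -∑ i, ∑ j, W i j * X i j
      map_add' := fun X Y => by
        simp only [Matrix.add_apply, mul_add, Finset.sum_add_distrib, neg_add]
      map_smul' := fun c X => by
        simp only [Matrix.smul_apply, smul_eq_mul, RingHom.id_apply, Finset.mul_sum, mul_neg]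
        simp only [mul_left_comm] }
  have hl0 : ∀ X ∈ graphPolytope G, l X ≤ 0 := fun X hX =>
    neg_nonpos.2 (Finset.sum_nonneg fun i _ => Finset.sum_nonneg fun j _ =>
      mul_nonneg (hW i j) (hX.1.1 i j))
  have hsub : ∀ X ∈ segment ℝ (g.permMatrix ℝ) (h.permMatrix ℝ), l X = 0 := by
    rintro X ⟨a, b, -, -, -, rfl⟩
    refine neg_eq_zero.2 (Finset.sum_eq_zero fun i _ => Finset.sum_eq_zero fun j _ => ?_)
    by_cases h1 : g i = j <;> by_cases h2 : h i = j <;> simp [W, h1, h2]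
  refine ⟨⟨l, ?_⟩, ?_⟩
  · exact (continuous_finsetSum _ fun i _ => continuous_finsetSum _ fun j _ =>
      continuous_const.mul (continuous_id.matrix_elem i j)).neg
  ext X
  constructor
  · intro hX
    refine ⟨(convex_graphPolytope G).segment_subset hg hh hX, fun Y hY => ?_⟩
    change l Y ≤ l X
    rw [hsub X hX]
    exact hl0 Y hY
  · rintro ⟨hX, hmax⟩
    refine hface X hX fun i j h1 h2 => ?_
    have hge : l (g.permMatrix ℝ) ≤ l X := hmax _ hg
    rw [hsub _ (left_mem_segment _ _ _)] at hge
    have hle : ∀ i j, 0 ≤ W i j * X i j := fun i j => mul_nonneg (hW i j) (hX.1.1 i j)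
    have hs : ∑ i, ∑ j, W i j * X i j = 0 :=
      neg_eq_zero.1 (le_antisymm (hl0 X hX) hge)
    have h3 := (Finset.sum_eq_zero_iff_of_nonneg
      fun i _ => Finset.sum_nonneg fun j _ => hle i j).1 hs i (Finset.mem_univ i)
    have h4 := (Finset.sum_eq_zero_iff_of_nonneg fun j _ => hle i j).1 h3 j (Finset.mem_univ j)
    simpa [W, h1, h2] using h4

theorem reachable_of_eq_permMatrix {V : Type*} [Fintype V] [DecidableEq V] (G : SimpleGraph V)
    [DecidableRel G.Adj] (n : ℕ) : ∀ (g h : Perm V)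
    (u v : {v : (graphPolytope G).extremePoints ℝ | IsIntegerMatrix (v : Matrix V V ℝ)}),
    (u : Matrix V V ℝ) = g.permMatrix ℝ → (v : Matrix V V ℝ) = h.permMatrix ℝ →
    (Finset.univ.filter fun i => g i ≠ h i).card ≤ n →
    ((oneSkeleton (graphPolytope G)).induce
      {v : (graphPolytope G).extremePoints ℝ | IsIntegerMatrix (v : Matrix V V ℝ)}).Reachable u v := by
  induction n using Nat.strong_induction_on with
  | _ n ih =>
    intro g h u v hu hv hn
    have hg : g.permMatrix ℝ ∈ graphPolytope G := hu ▸ u.1.2.1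
    have hh : h.permMatrix ℝ ∈ graphPolytope G := hv ▸ v.1.2.1
    by_cases huv : u = v
    · rw [huv]
    by_cases hface : ∀ X ∈ graphPolytope G, (∀ i j, g i ≠ j → h i ≠ j → X i j = 0) →
      X ∈ segment ℝ (g.permMatrix ℝ) (h.permMatrix ℝ)
    · refine SimpleGraph.Adj.reachable ?_
      refine ⟨fun e => huv (Subtype.ext e), ?_⟩
      have := isExposed_segment_permMatrix hg hh hface
      rwa [← hu, ← hv] at this
    · push Not at hface
      obtain ⟨X, hXG, hX, hseg⟩ := hface
      obtain ⟨k, hk, hkg, hkh, hki⟩ := exists_between_of_not_mem_segment hg hh hXG hX hseg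
      let w : {v : (graphPolytope G).extremePoints ℝ | IsIntegerMatrix (v : Matrix V V ℝ)} :=
        ⟨⟨_, permMatrix_mem_extremePoints_graphPolytope G hk⟩, isIntegerMatrix_permMatrix k⟩
      have h1 : (Finset.univ.filter fun i => g i ≠ k i).card < n := by
        refine lt_of_lt_of_le (Finset.card_lt_card ?_) hn
        -- Where `k` differs from `h` it equals `g`, so this `i` drops out of the disagreement set.
        obtain ⟨i, hi⟩ := not_forall.1 fun H => hkh (Equiv.ext H)
        refine Finset.ssubset_iff_of_subset (fun i hi => ?_) |>.2 ⟨i, ?_, ?_⟩ <;>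
        · have := hki i
          simp only [Finset.mem_filter, Finset.mem_univ, true_and] at *
          grind
      have h2 : (Finset.univ.filter fun i => k i ≠ h i).card < n := by
        refine lt_of_lt_of_le (Finset.card_lt_card ?_) hn
        obtain ⟨i, hi⟩ := not_forall.1 fun H => hkg (Equiv.ext H)
        refine Finset.ssubset_iff_of_subset (fun i hi => ?_) |>.2 ⟨i, ?_, ?_⟩ <;>
        · have := hki i
          simp only [Finset.mem_filter, Finset.mem_univ, true_and] at *
          grind
      exact (ih _ h1 g k u w hu rfl le_rfl).trans (ih _ h2 k h w v rfl hv le_rfl)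

theorem mainTheorem7 {V : Type*} [Fintype V] [DecidableEq V] (G : SimpleGraph V)
    [DecidableRel G.Adj] : IsQuasiIntegral (graphPolytope G) := by
  have h1 : (1 : Perm V).permMatrix ℝ ∈ graphPolytope G := by
    rw [Matrix.permMatrix_one]
    exact ⟨one_mem _, by simp⟩
  refine (SimpleGraph.connected_iff _).2 ⟨fun u v => ?_,
    ⟨⟨⟨_, permMatrix_mem_extremePoints_graphPolytope G h1⟩, isIntegerMatrix_permMatrix 1⟩⟩⟩
  obtain ⟨g, hg⟩ := exists_eq_permMatrix u.1.2.1.1 u.2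
  obtain ⟨h, hh⟩ := exists_eq_permMatrix v.1.2.1.1 v.2
  exact reachable_of_eq_permMatrix G _ g h u v hg hh le_rfl
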